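/- A \emph{diagram} is a plane diagram, up to planar isotopy, of an unoriented 4-valent rigid-vertex graph embedded in $\mathbb R^3$; its double points are vertices and crossings, and components that are circles without vertices are allowed. In the formulas below, $[\,\cdot\,]$ of a local picture stands for the value at a diagram containing this picture, and all diagrams in one formula agree outside a disc. For pictures with ends numbered counterclockwise around the disc, write $(ij)$ for an arc joining the ends $i$ and $j$ and $V(ijkl)$ for a vertex joined to the ends $i,j,k,l$; arcs listed together are disjoint. Let $K$ be a field (for instance $K=\mathbb Q(A,B,a)$), let $A,B,a\in K$ with $A\ne B$ and $a\neq 0$, and put $$\mu=\frac{a-a^{-1}}{A-B}+1,\quad \mathcal O=\frac{Aa^{-1}-Ba}{A-B}-(A+B),\quad \gamma=\frac{B^2a-A^2a^{-1}}{A-B}+AB,\quad \xi=\frac{B^3a-A^3a^{-1}}{A-B}.$$ Let $[\,\cdot\,]$ be a function from diagrams to $K$ with the following two properties. (i) Graphical calculus: (1) $[\text{a strand with a crossingless circle beside it}]=\mu\,[\text{strand}]$. (2) $[\text{a strand with a curl whose double point is a vertex}]=\mathcal O\,[\text{strand}]$. (3) If $\beta$ is the picture with four ends $1,2,3,4$ that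 consists of two vertices, one attached to the ends $1,2$ and the other to $3,4$, joined by two edges bounding an empty bigon, then $[\beta]=(1-AB)\,[(14)(23)]+\gamma\,[(12)(34)]-(A+B)\,[V(1234)]$. (4) For six ends, let $\Delta$ (resp. $\Delta'$) be the picture of three vertices spanning an empty triangle, attached to the pairs of ends $12,34,56$ (resp. $23,45,61$). Let $v_{ij}$ be the arc $(ij)$ together with a vertex joined to the other four ends. Then $$[\Delta']-[\Delta]=AB\bigl([v_{23}]-[v_{12}]+[v_{45}]-[v_{34}]+[v_{61}]-[v_{56}]\bigr)+\xi\bigl([(12)(34)(56)]-[(23)(45)(61)]\bigr).$$ (ii) Skein relation: let $\chi$ be the crossing with ends $1$ (bottom left), $2$ (bottom right), $3$ (top right), $4$ (top left) in which the strand from $2$ to $4$ passes over the strand from $1$ to $3$. Then $[\chi]=A\,[(12)(34)]+B\,[(14)(23)]+[V(1234)]$. Then $[\,\cdot\,]$ is invariant under regular isotopy of 4-valent rigid-vertex graphs, that is, under the generalized Reidemeister moves: II (cancelling two crossings of two strands), III (sliding a strand over or under a crossing), IV (sliding a strand over or under a vertex) and V (flipping a rigid vertex, i.e. replacing a vertex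 by crossing--vertex--opposite crossing), and under planar isotopy. Moreover, $[\text{curl}_+]=a\,[\text{strand}]$ and $[\text{curl}_-]=a^{-1}\,[\text{strand}]$, where $\text{curl}_\pm$ is a strand with a curl, to either side, whose crossing has sign $\pm1$ (for either orientation of the strand). -/

import Mathlib

/-!
Diagrams in the plane of unoriented 4-valent rigid-vertex graphs are encoded in Morse position with
respect to the height function: such a diagram is cut by horizontal lines into slices, and each
slice consists of vertical strands and exactly one of: a local minimum (cup), a local maximum (cap),
a vertex, or a crossing.  Vertex-free closed components are allowed.  Every diagram can be put in
this form, and planar isotopy is generated by local rules (see `PlanarRule`).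
-/

namespace RigidGraph

/-- The two crossings of two strands.  `slash`: the strand from bottom left to top right passes
over.  `backslash`: the strand from bottom right to top left passes over. -/
inductive Crossing
  | slash
  | backslash

/-- Switching over and under. -/
def Crossing.opp : Crossing → Crossing
  | .slash => .backslash
  | .backslash => .slash

/-- The 4-valent points of a diagram: rigid vertices and crossings. -/
inductive Node
  | vertex
  | crossing (c : Crossing)

/-- Rotation of a node by a quarter turn: a vertex is unchanged, and the two crossings are
exchanged. -/
def Node.rot : Node → Node
  | .vertex => .vertex
  | .crossing c => .crossing c.opp

/-- The elementary pieces of a diagram. -/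
inductive Gen
  | cup
  | cap
  | node (x : Node)

/-- Number of ends at the bottom. -/
def Gen.dom : Gen → ℕ
  | .cup => 0
  | .cap => 2
  | .node _ => 2

/-- Number of ends at the top. -/
def Gen.cod : Gen → ℕ
  | .cup => 2
  | .cap => 0
  | .node _ => 2

/-- An elementary piece together with the number `pos` of vertical strands to its left. -/
structure Slice where
  gen : Gen
  pos : ℕ

/-- A stack of slices, listed from bottom to top. -/
abbrev Word := List Slice

/-- The number of strands at the top of a stack of slices that starts with `m` strands at the
bottom, or `none` if the slices do not fit. -/
def Word.run : Word → ℕ → Option ℕ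
  | [], m => some m
  | s :: w, m =>
      if s.pos + s.gen.dom ≤ m then Word.run w (m - s.gen.dom + s.gen.cod) else none

/-- Putting `i` more vertical strands to the left. -/
def Word.shift (i : ℕ) (w : Word) : Word :=
  w.map fun s => ⟨s.gen, i + s.pos⟩

theorem Word.run_append (v w : Word) (m : ℕ) :
    Word.run (v ++ w) m = (Word.run v m).bind (Word.run w) := by
  induction v generalizing m with
  | nil => rfl
  | cons s v ih =>
    simp only [List.cons_append, Word.run]
    split
    · exact ih _
    · rfl

theorem Word.run_shift (w : Word) (i r : ℕ) {m n : ℕ} (h : Word.run w m = some n) :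
    Word.run (Word.shift i w) (i + m + r) = some (i + n + r) := by
  induction w generalizing m with
  | nil =>
    simp only [Word.run, Option.some.injEq] at h
    subst h
    rfl
  | cons s w ih =>
    simp only [Word.run] at h
    split at h
    · rename_i hs
      have h' := ih h
      have e : i + m + r - s.gen.dom + s.gen.cod = i + (m - s.gen.dom + s.gen.cod) + r := by
        omega
      simp only [Word.shift, List.map_cons, Word.run]
      rw [if_pos (by omega), e]
      exact h'
    · cases h

/-- A part of a diagram in a box, with `m` ends at the bottom and `n` ends at the top. -/
structure Tangle (m n : ℕ) where
  word : Word
  typed : Word.run word m = some n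

/-- A diagram of a 4-valent rigid-vertex graph: no free ends. -/
abbrev Diagram := Tangle 0 0

/-- A diagram from which the contents of a box with `m` ends at the bottom and `n` ends at the top
have been removed: `left` and `right` strands pass the box, and the rest of the diagram lies below
and above it. -/
structure Frame (m n : ℕ) where
  left : ℕ
  right : ℕ
  below : Tangle 0 (left + m + right)
  above : Tangle (left + n + right) 0

/-- The diagram obtained by inserting `T` into the empty box.  The diagrams `F.fill S` and
`F.fill T` differ only by the local pictures `S` and `T`. -/
def Frame.fill {m n : ℕ} (F : Frame m n) (T : Tangle m n) : Diagram where
  word := F.below.word ++ (Word.shift F.left T.word ++ F.above.word)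
  typed := by
    rw [Word.run_append, F.below.typed, Option.bind_some, Word.run_append,
      Word.run_shift _ _ _ T.typed, Option.bind_some, F.above.typed]

/-- A local minimum with `i` strands to its left. -/
def cup (i : ℕ) : Slice := ⟨.cup, i⟩

/-- A local maximum with `i` strands to its left. -/
def cap (i : ℕ) : Slice := ⟨.cap, i⟩

/-- A vertex or a crossing with `i` strands to its left. -/
def nd (x : Node) (i : ℕ) : Slice := ⟨.node x, i⟩

/-- A vertex with `i` strands to its left. -/
def vx (i : ℕ) : Slice := nd .vertex i

/-- A crossing with `i` strands to its left. -/
def cr (c : Crossing) (i : ℕ) : Slice := nd (.crossing c) i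

/-- `n` vertical strands. -/
def strands (n : ℕ) : Tangle n n := ⟨[], rfl⟩

/-- The local rules of planar isotopy. -/
inductive PlanarRule : ∀ {m n : ℕ}, Tangle m n → Tangle m n → Prop
  /-- Two pieces side by side exchange their heights. -/
  | interchange (g h : Gen) (d : ℕ) :
      PlanarRule
        (⟨[⟨g, 0⟩, ⟨h, g.cod + d⟩], by
            simp only [Word.run]
            rw [if_pos (by omega), if_pos (by omega)]
            congr 1
            omega⟩ :
          Tangle (g.dom + d + h.dom) (g.cod + d + h.cod))
        ⟨[⟨h, g.dom + d⟩, ⟨g, 0⟩], by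
            simp only [Word.run]
            rw [if_pos (by omega), if_pos (by omega)]
            congr 1
            omega⟩
  /-- A maximum and a minimum on the same strand cancel (two mirror images). -/
  | zigzag_left : PlanarRule (⟨[cup 1, cap 0], rfl⟩ : Tangle 1 1) (strands 1)
  | zigzag_right : PlanarRule (⟨[cup 0, cap 1], rfl⟩ : Tangle 1 1) (strands 1)
  /-- A node next to a maximum makes a quarter turn. -/
  | turn_cap (x : Node) :
      PlanarRule (⟨[nd x 0, cap 1], rfl⟩ : Tangle 3 1) ⟨[nd x.rot 1, cap 0], rfl⟩
  /-- A node next to a minimum makes a quarter turn. -/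
  | turn_cup (x : Node) :
      PlanarRule (⟨[cup 1, nd x 0], rfl⟩ : Tangle 1 3) ⟨[cup 0, nd x.rot 1], rfl⟩

/-- The generalized Reidemeister moves II to V; with planar isotopy available, all rotated versions
of these moves follow from the ones listed. -/
inductive ReidemeisterRule : ∀ {m n : ℕ}, Tangle m n → Tangle m n → Prop
  /-- Two strands are pulled apart. -/
  | move_II (c : Crossing) :
      ReidemeisterRule (⟨[cr c 0, cr c.opp 0], rfl⟩ : Tangle 2 2) (strands 2)
  /-- A strand slides over (`c = slash`) or under (`c = backslash`) a crossing `y`. -/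
  | move_III (c y : Crossing) :
      ReidemeisterRule (⟨[cr c 0, cr c 1, cr y 0], rfl⟩ : Tangle 3 3)
        ⟨[cr y 1, cr c 0, cr c 1], rfl⟩
  /-- A strand slides over (`c = slash`) or under (`c = backslash`) a vertex. -/
  | move_IV (c : Crossing) :
      ReidemeisterRule (⟨[cr c 0, cr c 1, vx 0], rfl⟩ : Tangle 3 3)
        ⟨[vx 1, cr c 0, cr c 1], rfl⟩
  /-- A rigid vertex is flipped over. -/
  | move_V (c : Crossing) :
      ReidemeisterRule (⟨[cr c 0, vx 0, cr c.opp 0], rfl⟩ : Tangle 2 2) ⟨[vx 0], rfl⟩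

/-- Two diagrams are the same except for one application of a planar rule. -/
def PlanarStep (D E : Diagram) : Prop :=
  ∃ (m n : ℕ) (F : Frame m n) (S T : Tangle m n),
    PlanarRule S T ∧ D = F.fill S ∧ E = F.fill T

/-- Two diagrams are the same except for one application of a Reidemeister move II to V. -/
def ReidemeisterStep (D E : Diagram) : Prop :=
  ∃ (m n : ℕ) (F : Frame m n) (S T : Tangle m n),
    ReidemeisterRule S T ∧ D = F.fill S ∧ E = F.fill T

/-- Planar isotopy of diagrams. -/
def PlanarIsotopic : Diagram → Diagram → Prop :=
  Relation.EqvGen PlanarStep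

/-- Regular isotopy of diagrams: planar isotopy and the moves II to V. -/
def RegularlyIsotopic : Diagram → Diagram → Prop :=
  Relation.EqvGen fun D E => PlanarStep D E ∨ ReidemeisterStep D E

section Calculus

variable {K : Type*} [Field K]

/-- The coefficient `μ`. -/
def mu (A B a : K) : K := (a - a⁻¹) / (A - B) + 1

/-- The coefficient written as a calligraphic O. -/
def loopCoeff (A B a : K) : K := (A * a⁻¹ - B * a) / (A - B) - (A + B)

/-- The coefficient `γ`. -/
def gam (A B a : K) : K := (B ^ 2 * a - A ^ 2 * a⁻¹) / (A - B) + A * B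

/-- The coefficient `ξ`. -/
def xi (A B a : K) : K := (B ^ 3 * a - A ^ 3 * a⁻¹) / (A - B)

/-- A strand with a circle beside it. -/
def circleBeside : Tangle 1 1 := ⟨[cup 1, cap 1], rfl⟩

/-- A strand with a curl (to the right) whose double point is the node `x`. -/
def curlRight (x : Node) : Tangle 1 1 := ⟨[cup 1, nd x 0, cap 1], rfl⟩

/-- A strand with a curl (to the left) whose double point is the node `x`. -/
def curlLeft (x : Node) : Tangle 1 1 := ⟨[cup 0, nd x 1, cap 0], rfl⟩

/-- One node. -/
def single (x : Node) : Tangle 2 2 := ⟨[nd x 0], rfl⟩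

/-- The two horizontal arcs: the bottom ends are joined, and the top ends are joined. -/
def horizontal : Tangle 2 2 := ⟨[cap 0, cup 0], rfl⟩

/-- Two vertices joined by two edges that bound an empty bigon. -/
def bigon : Tangle 2 2 := ⟨[vx 0, vx 0], rfl⟩

/-! Pictures with six ends, numbered counterclockwise: 1, 2, 3 at the bottom from left to right, and
4, 5, 6 at the top from right to left. -/

/-- Three vertices spanning a triangle, attached to the pairs of ends 12, 34 and 56. -/
def triangle12 : Tangle 3 3 := ⟨[vx 0, vx 1, vx 0], rfl⟩

/-- Three vertices spanning a triangle, attached to the pairs of ends 23, 45 and 61. -/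
def triangle23 : Tangle 3 3 := ⟨[vx 1, vx 0, vx 1], rfl⟩

/-- An arc joining 1 and 2; the other ends are joined to a vertex. -/
def arc12 : Tangle 3 3 := ⟨[cap 0, cup 1, vx 0], rfl⟩

/-- An arc joining 2 and 3; the other ends are joined to a vertex. -/
def arc23 : Tangle 3 3 := ⟨[cap 1, cup 1, vx 0], rfl⟩

/-- An arc joining 3 and 4; the other ends are joined to a vertex. -/
def arc34 : Tangle 3 3 := ⟨[vx 0], rfl⟩

/-- An arc joining 4 and 5; the other ends are joined to a vertex. -/
def arc45 : Tangle 3 3 := ⟨[vx 0, cap 1, cup 1], rfl⟩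

/-- An arc joining 5 and 6; the other ends are joined to a vertex. -/
def arc56 : Tangle 3 3 := ⟨[vx 0, cap 1, cup 0], rfl⟩

/-- An arc joining 6 and 1; the other ends are joined to a vertex. -/
def arc61 : Tangle 3 3 := ⟨[vx 1], rfl⟩

/-- Three arcs joining 12, 34 and 56. -/
def arcs12 : Tangle 3 3 := ⟨[cap 0, cup 0], rfl⟩

/-- Three arcs joining 23, 45 and 61. -/
def arcs23 : Tangle 3 3 := ⟨[cap 1, cup 1], rfl⟩

/-- The four identities of the graphical calculus. -/
structure GraphicalCalculus (A B a : K) (P : Diagram → K) : Prop where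
  circle : ∀ F : Frame 1 1, P (F.fill circleBeside) = mu A B a * P (F.fill (strands 1))
  loop : ∀ F : Frame 1 1,
    P (F.fill (curlRight .vertex)) = loopCoeff A B a * P (F.fill (strands 1))
  bigon : ∀ F : Frame 2 2,
    P (F.fill bigon) = (1 - A * B) * P (F.fill (strands 2)) + gam A B a * P (F.fill horizontal)
      - (A + B) * P (F.fill (single .vertex))
  triangle : ∀ F : Frame 3 3,
    P (F.fill triangle23) - P (F.fill triangle12) =
      A * B * (P (F.fill arc23) - P (F.fill arc12) + P (F.fill arc45) - P (F.fill arc34)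
        + P (F.fill arc61) - P (F.fill arc56))
      + xi A B a * (P (F.fill arcs12) - P (F.fill arcs23))

/-- The skein relation. -/
def SkeinRelation (A B : K) (P : Diagram → K) : Prop :=
  ∀ F : Frame 2 2,
    P (F.fill (single (.crossing .backslash))) =
      A * P (F.fill horizontal) + B * P (F.fill (strands 2)) + P (F.fill (single .vertex))

end Calculus

end RigidGraph

/-!
For a function `P` on diagrams, the formal linear combinations of tangles on `n` strands, modulo
those on which `P` vanishes in every frame, form an algebra with stacking as its product. In these
algebras the graphical calculus becomes a list of relations between the two horizontal arcs `e` and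
the vertex `v`, and the skein relation says that the two crossings are `A + B e + v` and
`B + A e + v`. The relations are symmetric in `A` and `B`, so both crossings are treated at once.

By the choice of `μ`, `𝒪`, `γ` and `ξ`, the two crossings are inverse to each other (move II) and
commute with `v` (move V), and `σ₁ σ₂ v₁ = v₂ σ₁ σ₂` on three strands (move IV). The same relation
with `e` in place of `v` is a consequence of move II, and since a crossing is a linear combination
of `1`, `e` and `v`, the two together give move III. Finally a crossing multiplies `e` by `a` or
`a⁻¹`, and closing one strand turns this into the values of the curls.
-/

namespace RigidGraph

variable {l m n p q : ℕ}

namespace Tangle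

@[ext]
theorem ext {S T : Tangle m n} (h : S.word = T.word) : S = T := by
  cases S
  cases T
  cases h
  rfl

/-- The tangle `S` with `T` on top of it. -/
def stack (S : Tangle l m) (T : Tangle m n) : Tangle l n where
  word := S.word ++ T.word
  typed := by rw [Word.run_append, S.typed, Option.bind_some, T.typed]

/-- The tangle `T` with `i` vertical strands to its left and `r` to its right. -/
def pad (i r : ℕ) (T : Tangle m n) : Tangle (i + m + r) (i + n + r) where
  word := Word.shift i T.word
  typed := Word.run_shift _ _ _ T.typed

/-- In the product `S * T` the factor `S` is the lower one, so that products are read in the order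
in which a `Word` lists its slices. -/
instance : Monoid (Tangle n n) where
  mul := stack
  one := strands n
  mul_assoc _ _ _ := ext (List.append_assoc _ _ _)
  one_mul _ := rfl
  mul_one _ := ext (List.append_nil _)

/-- Padding as a homomorphism of monoids. -/
def padHom (n i r : ℕ) : Tangle n n →* Tangle (i + n + r) (i + n + r) where
  toFun := pad i r
  map_one' := rfl
  map_mul' _ _ := ext List.map_append

end Tangle

namespace Frame

/-- The frame obtained from `F` by putting `X` at the bottom and `Z` at the top of its box. -/
def narrow (F : Frame m n) (X : Tangle m p) (Z : Tangle q n) : Frame p q where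
  left := F.left
  right := F.right
  below := F.below.stack (X.pad F.left F.right)
  above := (Z.pad F.left F.right).stack F.above

theorem fill_narrow (F : Frame m n) (X : Tangle m p) (Z : Tangle q n) (T : Tangle p q) :
    (F.narrow X Z).fill T = F.fill (X.stack (T.stack Z)) := by
  ext1
  simp only [fill, narrow, Tangle.stack, Tangle.pad, Word.shift, List.map_append,
    List.append_assoc]

/-- The frame obtained from `F` by putting `i` vertical strands at the left and `r` at the right of
its box. -/
def unpad (i r : ℕ) (F : Frame (i + p + r) (i + q + r)) : Frame p q where
  left := F.left + i
  right := r + F.right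
  below := ⟨F.below.word, by simpa only [add_assoc] using F.below.typed⟩
  above := ⟨F.above.word, by simpa only [add_assoc] using F.above.typed⟩

theorem fill_unpad (i r : ℕ) (F : Frame (i + p + r) (i + q + r)) (T : Tangle p q) :
    (F.unpad i r).fill T = F.fill (T.pad i r) := by
  ext1
  simp only [fill, unpad, Tangle.pad, Word.shift, List.map_map, Function.comp_def, add_assoc]

end Frame

section Value

/-- The values of `P` on all diagrams that contain the tangle `T`. Equality of these functions is
equality of local pictures in the sense of the function `P`. -/
def value {k : Type*} (P : Diagram → k) (T : Tangle m n) (F : Frame m n) : k :=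
  P (F.fill T)

variable {k : Type*} [CommRing k] (P : Diagram → k)

variable (k) in
/-- The linear map that takes the value of a tangle to the value of this tangle stacked between `X`
and `Z`. -/
def stackMap (X : Tangle m p) (Z : Tangle q n) : (Frame p q → k) →ₗ[k] (Frame m n → k) :=
  LinearMap.funLeft k k fun F => F.narrow X Z

@[simp]
theorem stackMap_value (X : Tangle m p) (Z : Tangle q n) (T : Tangle p q) :
    stackMap k X Z (value P T) = value P (X.stack (T.stack Z)) :=
  funext fun F => congrArg P (F.fill_narrow X Z T)

variable (k) in
/-- The linear map that takes the value of a tangle to the value of this tangle with `i` strands to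
its left and `r` to its right. -/
def padMap (p q i r : ℕ) : (Frame p q → k) →ₗ[k] (Frame (i + p + r) (i + q + r) → k) :=
  LinearMap.funLeft k k (Frame.unpad i r)

@[simp]
theorem padMap_value (i r : ℕ) (T : Tangle p q) :
    padMap k p q i r (value P T) = value P (T.pad i r) :=
  funext fun F => congrArg P (F.fill_unpad i r T)

variable {P}

theorem value_context_eq_smul {c : k} {S T : Tangle p q} (h : value P S = c • value P T)
    (i r : ℕ) (X : Tangle m (i + p + r)) (Z : Tangle (i + q + r) n) :
    value P (X.stack ((S.pad i r).stack Z)) = c • value P (X.stack ((T.pad i r).stack Z)) := by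
  simp only [← stackMap_value, ← padMap_value, h, map_smul]

end Value

section SkeinAlgebra

variable {k : Type*} [CommRing k] (P : Diagram → k)

/-- The linear extension of `value` to formal linear combinations of tangles. -/
noncomputable def linearValue (n : ℕ) : MonoidAlgebra k (Tangle n n) →ₗ[k] (Frame n n → k) :=
  Finsupp.linearCombination k (value P) ∘ₗ (MonoidAlgebra.coeffLinearEquiv k).toLinearMap

@[simp]
theorem linearValue_single (T : Tangle n n) (c : k) :
    linearValue P n (MonoidAlgebra.single T c) = c • value P T := by
  simp [linearValue]

theorem linearValue_mul_single (x : MonoidAlgebra k (Tangle n n)) (T : Tangle n n) (c : k) :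
    linearValue P n (x * MonoidAlgebra.single T c) =
      c • stackMap k (strands n) T (linearValue P n x) := by
  induction x using MonoidAlgebra.induction_linear with
  | zero => simp
  | add x y hx hy => simp only [add_mul, map_add, hx, hy, smul_add]
  | single S d =>
    simp only [MonoidAlgebra.single_mul_single, linearValue_single, map_smul, stackMap_value,
      smul_smul, mul_comm c d]
    rfl

theorem linearValue_single_mul (x : MonoidAlgebra k (Tangle n n)) (T : Tangle n n) (c : k) :
    linearValue P n (MonoidAlgebra.single T c * x) =
      c • stackMap k T (strands n) (linearValue P n x) := by
  induction x using MonoidAlgebra.induction_linear with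
  | zero => simp
  | add x y hx hy => simp only [mul_add, map_add, hx, hy, smul_add]
  | single S d =>
    simp only [MonoidAlgebra.single_mul_single, linearValue_single, map_smul, stackMap_value,
      smul_smul]
    exact congrArg (fun S => (c * d) • value P (T * S)) (mul_one S).symm

theorem linearValue_mapDomain_pad (i r : ℕ) (x : MonoidAlgebra k (Tangle n n)) :
    linearValue P _ (MonoidAlgebra.mapDomainAlgHom k k (Tangle.padHom n i r) x) =
      padMap k n n i r (linearValue P n x) := by
  induction x using MonoidAlgebra.induction_linear with
  | zero => simp
  | add x y hx hy => simp only [map_add, hx, hy]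
  | single T c =>
    simp only [MonoidAlgebra.mapDomainAlgHom_apply, MonoidAlgebra.mapDomain_single,
      linearValue_single, map_smul, padMap_value]
    rfl

variable {P}

theorem linearValue_mul_right_congr {x x' : MonoidAlgebra k (Tangle n n)}
    (h : linearValue P n x = linearValue P n x') (y : MonoidAlgebra k (Tangle n n)) :
    linearValue P n (x * y) = linearValue P n (x' * y) := by
  induction y using MonoidAlgebra.induction_linear with
  | zero => simp
  | add y z hy hz => simp only [mul_add, map_add, hy, hz]
  | single T c => rw [linearValue_mul_single, linearValue_mul_single, h]

theorem linearValue_mul_left_congr {y y' : MonoidAlgebra k (Tangle n n)}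
    (h : linearValue P n y = linearValue P n y') (x : MonoidAlgebra k (Tangle n n)) :
    linearValue P n (x * y) = linearValue P n (x * y') := by
  induction x using MonoidAlgebra.induction_linear with
  | zero => simp
  | add x z hx hz => simp only [add_mul, map_add, hx, hz]
  | single T c => rw [linearValue_single_mul, linearValue_single_mul, h]

variable (P)

/-- The congruence that identifies formal linear combinations of tangles with equal values. -/
noncomputable def skeinCon (n : ℕ) : RingCon (MonoidAlgebra k (Tangle n n)) where
  toSetoid := Setoid.ker (linearValue P n)
  mul' {_ x _ _} hx hy :=
    (linearValue_mul_right_congr hx _).trans (linearValue_mul_left_congr hy x)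
  add' hx hy := by
    simp only [Setoid.ker_def, map_add] at hx hy ⊢
    rw [hx, hy]

/-- The skein algebra of `P` on `n` strands: formal linear combinations of tangles with `n` ends at
the bottom and at the top, modulo those on which `P` vanishes in all frames. -/
abbrev SkeinAlgebra (n : ℕ) := (skeinCon P n).Quotient

namespace SkeinAlgebra

/-- The class of a tangle. -/
noncomputable def of : Tangle n n →* SkeinAlgebra P n :=
  (skeinCon P n).mk'.toMonoidHom.comp (MonoidAlgebra.of k (Tangle n n))

/-- The value of an element of the skein algebra in all frames. -/
noncomputable def toValue : SkeinAlgebra P n →ₗ[k] (Frame n n → k) where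
  toFun := Quotient.lift (linearValue P n) fun _ _ h => h
  map_add' := by
    rintro ⟨x⟩ ⟨y⟩
    exact map_add (linearValue P n) x y
  map_smul' c := by
    rintro ⟨x⟩
    exact map_smul (linearValue P n) c x

theorem toValue_injective : Function.Injective (toValue P (n := n)) := by
  rintro ⟨x⟩ ⟨y⟩ h
  exact Quotient.sound h

@[simp]
theorem toValue_of (T : Tangle n n) : toValue P (of P T) = value P T :=
  (linearValue_single P T 1).trans (one_smul _ _)

variable {P} in
theorem of_eq_of_iff {S T : Tangle n n} : of P S = of P T ↔ value P S = value P T := by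
  rw [← (toValue_injective P).eq_iff, toValue_of, toValue_of]

/-- Padding with `i` strands on the left and `r` on the right as a map of skein algebras. -/
noncomputable def pad (n i r : ℕ) : SkeinAlgebra P n →ₐ[k] SkeinAlgebra P (i + n + r) :=
  (skeinCon P n).liftₐ
    (((skeinCon P (i + n + r)).mkₐ (α := k)).comp
      (MonoidAlgebra.mapDomainAlgHom k k (Tangle.padHom n i r)))
    fun {x y} h => Quotient.sound <|
      (linearValue_mapDomain_pad P i r x).trans <|
        (congrArg (padMap k n n i r) h).trans (linearValue_mapDomain_pad P i r y).symm

theorem pad_of (i r : ℕ) (T : Tangle n n) : pad P n i r (of P T) = of P (T.pad i r) :=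
  congrArg (skeinCon P (i + n + r)).mk' MonoidAlgebra.mapDomain_single

end SkeinAlgebra

end SkeinAlgebra

section Relations

variable {k R : Type*} [CommRing k] [Ring R] [Algebra k R]

/-- The coefficient of the two horizontal arcs in the resolution of a bigon that is forced by move
II, for a circle of value `δ` and a curl at a vertex of value `o`. -/
def bigonCoeff (A B δ o : k) : k := -(A ^ 2 + B ^ 2 + A * B * δ + (A + B) * o)

/-- The coefficient of the three arcs in the triangle relation that is forced by move IV. -/
def triangleCoeff (A B δ o : k) : k := A * B * o + (A + B) * bigonCoeff A B δ o

theorem bigonCoeff_swap (A B δ o : k) : bigonCoeff B A δ o = bigonCoeff A B δ o := by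
  unfold bigonCoeff
  ring

theorem triangleCoeff_swap (A B δ o : k) : triangleCoeff B A δ o = triangleCoeff A B δ o := by
  rw [triangleCoeff, triangleCoeff, bigonCoeff_swap]
  ring

/-- The linear combination that resolves a crossing into the two smoothings `1` and `e` and the
vertex `v`. The opposite crossing is the resolution with `A` and `B` exchanged. -/
def resolution (A B : k) (e v : R) : R := A • 1 + B • e + v

theorem map_resolution {R' : Type*} [Ring R'] [Algebra k R'] (f : R →ₐ[k] R') (A B : k)
    (e v : R) :
    f (resolution A B e v) = resolution A B (f e) (f v) := by
  simp only [resolution, map_add, map_smul, map_one]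

/-- The graphical calculus on two strands: `e` stands for the two horizontal arcs, `v` for the
vertex, `δ` for a circle and `o` for a curl at a vertex. -/
structure TwoStrandRelations (A B δ o : k) (e v : R) : Prop where
  arcs_mul_arcs : e * e = δ • e
  arcs_mul_vertex : e * v = o • e
  vertex_mul_arcs : v * e = o • e
  vertex_mul_vertex : v * v = (1 - A * B) • 1 + bigonCoeff A B δ o • e - (A + B) • v

namespace TwoStrandRelations

variable {A B δ o : k} {e v : R}

theorem swap (h : TwoStrandRelations A B δ o e v) : TwoStrandRelations B A δ o e v where
  __ := h
  vertex_mul_vertex := by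
    rw [h.vertex_mul_vertex, mul_comm A B, add_comm A B, bigonCoeff_swap]

theorem map {R' : Type*} [Ring R'] [Algebra k R'] (h : TwoStrandRelations A B δ o e v)
    (f : R →ₐ[k] R') : TwoStrandRelations A B δ o (f e) (f v) where
  arcs_mul_arcs := by rw [← map_mul, h.arcs_mul_arcs, map_smul]
  arcs_mul_vertex := by rw [← map_mul, h.arcs_mul_vertex, map_smul]
  vertex_mul_arcs := by rw [← map_mul, h.vertex_mul_arcs, map_smul]
  vertex_mul_vertex := by
    simp only [← map_mul, h.vertex_mul_vertex, map_sub, map_add, map_smul, map_one]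

theorem resolution_mul_arcs (h : TwoStrandRelations A B δ o e v) :
    resolution A B e v * e = (A + B * δ + o) • e := by
  simp only [resolution, add_mul, smul_mul_assoc, one_mul, h.arcs_mul_arcs, h.vertex_mul_arcs]
  module

theorem resolution_mul_swap (h : TwoStrandRelations A B δ o e v) :
    resolution A B e v * resolution B A e v = 1 := by
  simp only [resolution, add_mul, mul_add, smul_mul_assoc, mul_smul_comm, one_mul, mul_one,
    h.arcs_mul_arcs, h.arcs_mul_vertex, h.vertex_mul_arcs, h.vertex_mul_vertex, bigonCoeff]
  module

theorem commute_resolution (h : TwoStrandRelations A B δ o e v) :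
    Commute (resolution A B e v) v := by
  simp only [commute_iff_eq, resolution, add_mul, mul_add, smul_mul_assoc, mul_smul_comm, one_mul,
    mul_one, h.arcs_mul_vertex, h.vertex_mul_arcs]

theorem resolution_mul_vertex_mul_swap (h : TwoStrandRelations A B δ o e v) :
    resolution A B e v * v * resolution B A e v = v := by
  rw [h.commute_resolution.eq, mul_assoc, h.resolution_mul_swap, mul_one]

end TwoStrandRelations

/-- The graphical calculus on three strands, where `e₁`, `v₁` are at the two strands on the left and
`e₂`, `v₂` at the two strands on the right. -/
structure ThreeStrandRelations (A B δ o : k) (e₁ v₁ e₂ v₂ : R) : Prop where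
  left : TwoStrandRelations A B δ o e₁ v₁
  right : TwoStrandRelations A B δ o e₂ v₂
  straighten_left : e₁ * e₂ * e₁ = e₁
  straighten_right : e₂ * e₁ * e₂ = e₂
  turn_above : e₁ * v₂ = e₁ * e₂ * v₁
  turn_below : v₂ * e₁ = v₁ * e₂ * e₁
  triangle : v₂ * v₁ * v₂ - v₁ * v₂ * v₁ =
    (A * B) • (e₂ * v₁ - e₁ * v₂ + v₁ * e₂ - v₁ + v₂ - v₂ * e₁) +
      triangleCoeff A B δ o • (e₁ - e₂)

namespace ThreeStrandRelations

variable {A B δ o : k} {e₁ v₁ e₂ v₂ : R}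

theorem swap (h : ThreeStrandRelations A B δ o e₁ v₁ e₂ v₂) :
    ThreeStrandRelations B A δ o e₁ v₁ e₂ v₂ where
  __ := h
  left := h.left.swap
  right := h.right.swap
  triangle := by rw [h.triangle, mul_comm A B, triangleCoeff_swap]

theorem turn_above' (h : ThreeStrandRelations A B δ o e₁ v₁ e₂ v₂) :
    e₂ * e₁ * v₂ = e₂ * v₁ := by
  rw [mul_assoc, h.turn_above, ← mul_assoc, ← mul_assoc, h.straighten_right]

theorem turn_below' (h : ThreeStrandRelations A B δ o e₁ v₁ e₂ v₂) :
    v₂ * e₁ * e₂ = v₁ * e₂ := by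
  rw [h.turn_below, mul_assoc, mul_assoc, ← mul_assoc e₂, h.straighten_right]

theorem slide_arcs (h : ThreeStrandRelations A B δ o e₁ v₁ e₂ v₂) :
    resolution A B e₁ v₁ * resolution A B e₂ v₂ * e₁ =
      e₂ * (resolution A B e₁ v₁ * resolution A B e₂ v₂) := by
  have turn_left : resolution A B e₂ v₂ * e₁ = resolution B A e₁ v₁ * (e₂ * e₁) := by
    simp only [resolution, add_mul, smul_mul_assoc, one_mul, ← mul_assoc, h.straighten_left,
      h.turn_below]
    abel
  have turn_right : e₂ * resolution A B e₁ v₁ = e₂ * e₁ * resolution B A e₂ v₂ := by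
    simp only [resolution, mul_add, mul_smul_comm, mul_one, h.straighten_right, h.turn_above']
    abel
  calc resolution A B e₁ v₁ * resolution A B e₂ v₂ * e₁
      = resolution A B e₁ v₁ * resolution B A e₁ v₁ * (e₂ * e₁) := by
        rw [mul_assoc, turn_left, mul_assoc]
    _ = e₂ * e₁ * (resolution B A e₂ v₂ * resolution A B e₂ v₂) := by
        rw [h.left.resolution_mul_swap, h.right.swap.resolution_mul_swap, one_mul, mul_one]
    _ = e₂ * (resolution A B e₁ v₁ * resolution A B e₂ v₂) := by
        rw [← mul_assoc, ← turn_right, mul_assoc]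

theorem slide_vertex (h : ThreeStrandRelations A B δ o e₁ v₁ e₂ v₂) :
    resolution A B e₁ v₁ * resolution A B e₂ v₂ * v₁ =
      v₂ * (resolution A B e₁ v₁ * resolution A B e₂ v₂) := by
  have arcs_vertices : e₁ * v₂ * v₁ =
      (1 - A * B) • (e₁ * e₂) + bigonCoeff A B δ o • e₁ - (A + B) • (e₁ * v₂) := by
    rw [h.turn_above, mul_assoc, h.left.vertex_mul_vertex]
    simp only [mul_sub, mul_add, mul_smul_comm, mul_one, h.straighten_left]
  have vertices_arcs : v₂ * v₁ * e₂ =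
      (1 - A * B) • (e₁ * e₂) + bigonCoeff A B δ o • e₂ - (A + B) • (v₁ * e₂) := by
    rw [mul_assoc, ← h.turn_below', mul_assoc, ← mul_assoc, h.right.vertex_mul_vertex]
    simp only [sub_mul, add_mul, smul_mul_assoc, one_mul, ← mul_assoc, h.straighten_right]
  have vertex_arcs_vertex : v₂ * e₁ * v₂ = v₁ * e₂ * v₁ := by
    rw [h.turn_below, mul_assoc, mul_assoc, ← mul_assoc e₂, h.turn_above', mul_assoc]
  simp only [resolution, add_mul, mul_add, smul_mul_assoc, mul_smul_comm, one_mul, mul_one,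
    ← mul_assoc, smul_add, arcs_vertices, vertices_arcs, vertex_arcs_vertex, ← h.turn_above,
    h.turn_below', sub_eq_iff_eq_add.mp h.triangle, h.left.arcs_mul_vertex,
    h.left.vertex_mul_vertex, h.right.vertex_mul_arcs, h.right.vertex_mul_vertex, triangleCoeff]
  module

theorem slide_resolution (h : ThreeStrandRelations A B δ o e₁ v₁ e₂ v₂) (s t : k) :
    resolution A B e₁ v₁ * resolution A B e₂ v₂ * resolution s t e₁ v₁ =
      resolution s t e₂ v₂ * (resolution A B e₁ v₁ * resolution A B e₂ v₂) := by
  generalize hσ : resolution A B e₁ v₁ * resolution A B e₂ v₂ = σ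
  have slide_arcs : σ * e₁ = e₂ * σ := hσ ▸ h.slide_arcs
  have slide_vertex : σ * v₁ = v₂ * σ := hσ ▸ h.slide_vertex
  simp only [resolution, add_mul, mul_add, smul_mul_assoc, mul_smul_comm, one_mul, mul_one,
    slide_arcs, slide_vertex]

end ThreeStrandRelations

/-- The coefficient of the two vertical arcs in the resolution of a crossing; that of the two
horizontal arcs belongs to the opposite crossing. -/
def Crossing.smoothing (A B : k) : Crossing → k
  | .slash => A
  | .backslash => B

theorem TwoStrandRelations.smoothing {A B δ o : k} {e v : R}
    (h : TwoStrandRelations A B δ o e v) (c : Crossing) :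
    TwoStrandRelations (c.smoothing A B) (c.opp.smoothing A B) δ o e v := by
  cases c
  exacts [h, h.swap]

theorem ThreeStrandRelations.smoothing {A B δ o : k} {e₁ v₁ e₂ v₂ : R}
    (h : ThreeStrandRelations A B δ o e₁ v₁ e₂ v₂) (c : Crossing) :
    ThreeStrandRelations (c.smoothing A B) (c.opp.smoothing A B) δ o e₁ v₁ e₂ v₂ := by
  cases c
  exacts [h, h.swap]

end Relations

section PlanarIsotopy

variable {k : Type*} {P : Diagram → k}

theorem Crossing.opp_opp (c : Crossing) : c.opp.opp = c := by
  cases c <;> rfl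

theorem Node.rot_rot : ∀ x : Node, x.rot.rot = x
  | .vertex => rfl
  | .crossing c => congrArg Node.crossing c.opp_opp

/-- The function `P` takes the same value on planar isotopic diagrams. -/
def IsPlanarInvariant (P : Diagram → k) : Prop :=
  ∀ D E, PlanarIsotopic D E → P D = P E

/-- A tangle with four ends, rotated by a quarter turn. -/
def Tangle.rotate (T : Tangle 2 2) : Tangle 2 2 :=
  Tangle.stack ⟨[cup 0], rfl⟩ ((T.pad 1 1).stack ⟨[cap 2], rfl⟩)

section RotateMap

variable [CommRing k]

variable (k) in
/-- The linear map that takes the value of a tangle to the value of the rotated tangle. -/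
def rotateMap : (Frame 2 2 → k) →ₗ[k] (Frame 2 2 → k) :=
  stackMap k ⟨[cup 0], rfl⟩ ⟨[cap 2], rfl⟩ ∘ₗ padMap k 2 2 1 1

theorem rotateMap_value (P : Diagram → k) (T : Tangle 2 2) :
    rotateMap k (value P T) = value P T.rotate :=
  (congrArg _ (padMap_value P 1 1 T)).trans (stackMap_value P _ _ _)

end RotateMap

/-- The partial closure of a tangle on two strands that joins the ends of its right strand. -/
def Tangle.closeRight (T : Tangle 2 2) : Tangle 1 1 :=
  Tangle.stack ⟨[cup 1], rfl⟩ ((T.pad 0 1).stack ⟨[cap 1], rfl⟩)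

/-- The partial closure of a tangle on two strands that joins the ends of its left strand. -/
def Tangle.closeLeft (T : Tangle 2 2) : Tangle 1 1 :=
  Tangle.stack ⟨[cup 0], rfl⟩ ((T.pad 1 0).stack ⟨[cap 0], rfl⟩)

namespace IsPlanarInvariant

theorem value_context_eq (hP : IsPlanarInvariant P) {S T : Tangle p q} (h : PlanarRule S T)
    (i r : ℕ) (X : Tangle m (i + p + r)) (Z : Tangle (i + q + r) n) :
    value P (X.stack ((S.pad i r).stack Z)) = value P (X.stack ((T.pad i r).stack Z)) := by
  funext F
  simp only [value, ← Frame.fill_narrow, ← Frame.fill_unpad]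
  exact hP _ _ (.rel _ _ ⟨p, q, (F.narrow X Z).unpad i r, S, T, h, rfl, rfl⟩)

theorem value_rotate_node (hP : IsPlanarInvariant P) (x : Node) :
    value P (single x.rot).rotate = value P (single x) :=
  calc value P (⟨[cup 0, nd x.rot 1, cap 2], rfl⟩ : Tangle 2 2)
    _ = value P (⟨[cup 1, nd x 0, cap 2], rfl⟩ : Tangle 2 2) :=
      (hP.value_context_eq (.turn_cup x) 0 1 ⟨[], rfl⟩ ⟨[cap 2], rfl⟩).symm
    _ = value P (⟨[cup 1, cap 2, nd x 0], rfl⟩ : Tangle 2 2) :=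
      hP.value_context_eq (.interchange (.node x) .cap 0) 0 0 ⟨[cup 1], rfl⟩ ⟨[], rfl⟩
    _ = value P (⟨[nd x 0], rfl⟩ : Tangle 2 2) :=
      hP.value_context_eq .zigzag_right 1 0 ⟨[], rfl⟩ ⟨[nd x 0], rfl⟩

theorem value_rotate_strands (hP : IsPlanarInvariant P) :
    value P (strands 2).rotate = value P horizontal :=
  hP.value_context_eq (.interchange .cup .cap 0) 0 0 ⟨[], rfl⟩ ⟨[], rfl⟩

theorem value_rotate_horizontal (hP : IsPlanarInvariant P) :
    value P horizontal.rotate = value P (strands 2) :=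
  calc value P (⟨[cup 0, cap 1, cup 1, cap 2], rfl⟩ : Tangle 2 2)
    _ = value P (⟨[cup 1, cap 2], rfl⟩ : Tangle 2 2) :=
      hP.value_context_eq .zigzag_right 0 1 ⟨[], rfl⟩ ⟨[cup 1, cap 2], rfl⟩
    _ = value P (strands 2) :=
      hP.value_context_eq .zigzag_right 1 0 ⟨[], rfl⟩ ⟨[], rfl⟩

theorem value_horizontal_mul_horizontal (hP : IsPlanarInvariant P) :
    value P (horizontal * horizontal) = value P (circleBeside.pad 1 0 * horizontal) :=
  calc value P (⟨[cap 0, cup 0, cap 0, cup 0], rfl⟩ : Tangle 2 2)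
    _ = value P (⟨[cup 2, cap 0, cap 0, cup 0], rfl⟩ : Tangle 2 2) :=
      hP.value_context_eq (.interchange .cap .cup 0) 0 0 ⟨[], rfl⟩ ⟨[cap 0, cup 0], rfl⟩
    _ = value P (⟨[cup 2, cap 2, cap 0, cup 0], rfl⟩ : Tangle 2 2) :=
      hP.value_context_eq (.interchange .cap .cap 0) 0 0 ⟨[cup 2], rfl⟩ ⟨[cup 0], rfl⟩

theorem value_node_mul_horizontal (hP : IsPlanarInvariant P) (x : Node) :
    value P (single x * horizontal) = value P ((curlRight x.rot).pad 1 0 * horizontal) :=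
  calc value P (⟨[nd x 0, cap 0, cup 0], rfl⟩ : Tangle 2 2)
    _ = value P (⟨[nd x 0, cup 2, cap 1, cap 0, cup 0], rfl⟩ : Tangle 2 2) :=
      (hP.value_context_eq .zigzag_left 1 0 ⟨[nd x 0], rfl⟩ ⟨[cap 0, cup 0], rfl⟩).symm
    _ = value P (⟨[cup 2, nd x 0, cap 1, cap 0, cup 0], rfl⟩ : Tangle 2 2) :=
      hP.value_context_eq (.interchange (.node x) .cup 0) 0 0 ⟨[], rfl⟩ ⟨[cap 1, cap 0, cup 0], rfl⟩
    _ = value P (⟨[cup 2, nd x.rot 1, cap 0, cap 0, cup 0], rfl⟩ : Tangle 2 2) :=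
      hP.value_context_eq (.turn_cap x) 0 1 ⟨[cup 2], rfl⟩ ⟨[cap 0, cup 0], rfl⟩
    _ = value P (⟨[cup 2, nd x.rot 1, cap 2, cap 0, cup 0], rfl⟩ : Tangle 2 2) :=
      hP.value_context_eq (.interchange .cap .cap 0) 0 0 ⟨[cup 2, nd x.rot 1], rfl⟩ ⟨[cup 0], rfl⟩

theorem value_horizontal_mul_node (hP : IsPlanarInvariant P) (x : Node) :
    value P (horizontal * single x) = value P (horizontal * (curlRight x.rot).pad 1 0) :=
  calc value P (⟨[cap 0, cup 0, nd x 0], rfl⟩ : Tangle 2 2)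
    _ = value P (⟨[cap 0, cup 0, cup 1, cap 2, nd x 0], rfl⟩ : Tangle 2 2) :=
      (hP.value_context_eq .zigzag_right 1 0 ⟨[cap 0, cup 0], rfl⟩ ⟨[nd x 0], rfl⟩).symm
    _ = value P (⟨[cap 0, cup 0, cup 1, nd x 0, cap 2], rfl⟩ : Tangle 2 2) :=
      (hP.value_context_eq (.interchange (.node x) .cap 0) 0 0 ⟨[cap 0, cup 0, cup 1], rfl⟩
        ⟨[], rfl⟩).symm
    _ = value P (⟨[cap 0, cup 0, cup 0, nd x.rot 1, cap 2], rfl⟩ : Tangle 2 2) :=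
      hP.value_context_eq (.turn_cup x) 0 1 ⟨[cap 0, cup 0], rfl⟩ ⟨[cap 2], rfl⟩
    _ = value P (⟨[cap 0, cup 0, cup 2, nd x.rot 1, cap 2], rfl⟩ : Tangle 2 2) :=
      (hP.value_context_eq (.interchange .cup .cup 0) 0 0 ⟨[cap 0], rfl⟩
        ⟨[nd x.rot 1, cap 2], rfl⟩).symm

theorem value_arcs12_mul_arcs23_mul_arcs12 (hP : IsPlanarInvariant P) :
    value P (arcs12 * arcs23 * arcs12) = value P arcs12 :=
  calc value P (⟨[cap 0, cup 0, cap 1, cup 1, cap 0, cup 0], rfl⟩ : Tangle 3 3)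
    _ = value P (⟨[cap 0, cup 1, cap 0, cup 0], rfl⟩ : Tangle 3 3) :=
      hP.value_context_eq .zigzag_right 0 0 ⟨[cap 0], rfl⟩ ⟨[cup 1, cap 0, cup 0], rfl⟩
    _ = value P (⟨[cap 0, cup 0], rfl⟩ : Tangle 3 3) :=
      hP.value_context_eq .zigzag_left 0 0 ⟨[cap 0], rfl⟩ ⟨[cup 0], rfl⟩

theorem value_arcs23_mul_arcs12_mul_arcs23 (hP : IsPlanarInvariant P) :
    value P (arcs23 * arcs12 * arcs23) = value P arcs23 :=
  calc value P (⟨[cap 1, cup 1, cap 0, cup 0, cap 1, cup 1], rfl⟩ : Tangle 3 3)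
    _ = value P (⟨[cap 1, cup 0, cap 1, cup 1], rfl⟩ : Tangle 3 3) :=
      hP.value_context_eq .zigzag_left 0 0 ⟨[cap 1], rfl⟩ ⟨[cup 0, cap 1, cup 1], rfl⟩
    _ = value P (⟨[cap 1, cup 1], rfl⟩ : Tangle 3 3) :=
      hP.value_context_eq .zigzag_right 0 0 ⟨[cap 1], rfl⟩ ⟨[cup 1], rfl⟩

theorem value_arc61_mul_arcs12 (hP : IsPlanarInvariant P) :
    value P (arc61 * arcs12) = value P arc56 :=
  hP.value_context_eq (.turn_cap .vertex) 0 0 ⟨[], rfl⟩ ⟨[cup 0], rfl⟩ |>.symm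

theorem value_arcs12_mul_arc61 (hP : IsPlanarInvariant P) :
    value P (arcs12 * arc61) = value P arc12 :=
  hP.value_context_eq (.turn_cup .vertex) 0 0 ⟨[cap 0], rfl⟩ ⟨[], rfl⟩ |>.symm

theorem value_arc34_mul_arcs23_mul_arcs12 (hP : IsPlanarInvariant P) :
    value P (arc34 * arcs23 * arcs12) = value P arc56 :=
  hP.value_context_eq .zigzag_left 0 0 ⟨[vx 0, cap 1], rfl⟩ ⟨[cup 0], rfl⟩

theorem value_arcs12_mul_arcs23_mul_arc34 (hP : IsPlanarInvariant P) :
    value P (arcs12 * arcs23 * arc34) = value P arc12 :=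
  hP.value_context_eq .zigzag_right 0 0 ⟨[cap 0], rfl⟩ ⟨[cup 1, vx 0], rfl⟩

theorem value_curlLeft (hP : IsPlanarInvariant P) (x : Node) :
    value P (curlLeft x) = value P (single x.rot * horizontal).closeRight :=
  calc value P (⟨[cup 0, nd x 1, cap 0], rfl⟩ : Tangle 1 1)
    _ = value P (⟨[cup 0, nd x.rot.rot 1, cap 0], rfl⟩ : Tangle 1 1) := by
      rw [x.rot_rot]
    _ = value P (⟨[cup 1, nd x.rot 0, cap 0], rfl⟩ : Tangle 1 1) :=
      (hP.value_context_eq (.turn_cup x.rot) 0 0 ⟨[], rfl⟩ ⟨[cap 0], rfl⟩).symm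
    _ = value P (⟨[cup 1, nd x.rot 0, cap 0, cup 0, cap 1], rfl⟩ : Tangle 1 1) :=
      (hP.value_context_eq .zigzag_right 0 0 ⟨[cup 1, nd x.rot 0, cap 0], rfl⟩ ⟨[], rfl⟩).symm

theorem value_curlRight (hP : IsPlanarInvariant P) (x : Node) :
    value P (curlRight x) = value P (single x.rot * horizontal).closeLeft :=
  calc value P (⟨[cup 1, nd x 0, cap 1], rfl⟩ : Tangle 1 1)
    _ = value P (⟨[cup 0, nd x.rot 1, cap 1], rfl⟩ : Tangle 1 1) :=
      hP.value_context_eq (.turn_cup x) 0 0 ⟨[], rfl⟩ ⟨[cap 1], rfl⟩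
    _ = value P (⟨[cup 0, nd x.rot 1, cap 1, cup 1, cap 0], rfl⟩ : Tangle 1 1) :=
      (hP.value_context_eq .zigzag_left 0 0 ⟨[cup 0, nd x.rot 1, cap 1], rfl⟩ ⟨[], rfl⟩).symm

theorem value_closeRight_horizontal (hP : IsPlanarInvariant P) :
    value P horizontal.closeRight = value P (strands 1) :=
  calc value P (⟨[cup 1, cap 0, cup 0, cap 1], rfl⟩ : Tangle 1 1)
    _ = value P (⟨[cup 0, cap 1], rfl⟩ : Tangle 1 1) :=
      hP.value_context_eq .zigzag_left 0 0 ⟨[], rfl⟩ ⟨[cup 0, cap 1], rfl⟩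
    _ = value P (strands 1) :=
      hP.value_context_eq .zigzag_right 0 0 ⟨[], rfl⟩ ⟨[], rfl⟩

theorem value_closeLeft_horizontal (hP : IsPlanarInvariant P) :
    value P horizontal.closeLeft = value P (strands 1) :=
  calc value P (⟨[cup 0, cap 1, cup 1, cap 0], rfl⟩ : Tangle 1 1)
    _ = value P (⟨[cup 1, cap 0], rfl⟩ : Tangle 1 1) :=
      hP.value_context_eq .zigzag_right 0 0 ⟨[], rfl⟩ ⟨[cup 1, cap 0], rfl⟩
    _ = value P (strands 1) :=
      hP.value_context_eq .zigzag_left 0 0 ⟨[], rfl⟩ ⟨[], rfl⟩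

variable [CommRing k] {t : k} {x : Node}

theorem value_curlLeft_eq_smul (hP : IsPlanarInvariant P)
    (h : value P (single x.rot * horizontal) = t • value P horizontal) :
    value P (curlLeft x) = t • value P (strands 1) :=
  (hP.value_curlLeft x).trans <| (value_context_eq_smul h 0 1 _ _).trans <|
    congrArg (t • ·) hP.value_closeRight_horizontal

theorem value_curlRight_eq_smul (hP : IsPlanarInvariant P)
    (h : value P (single x.rot * horizontal) = t • value P horizontal) :
    value P (curlRight x) = t • value P (strands 1) :=
  (hP.value_curlRight x).trans <| (value_context_eq_smul h 1 0 _ _).trans <|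
    congrArg (t • ·) hP.value_closeLeft_horizontal

end IsPlanarInvariant

end PlanarIsotopy

section Coefficients

variable {K : Type*} [Field K] {A B : K} (a : K)

/-- The factor by which a curl with the crossing `c` multiplies the value of a strand. -/
def Crossing.curlFactor : Crossing → K
  | .slash => a
  | .backslash => a⁻¹

theorem smoothing_add_mul_mu_add_loopCoeff (hAB : A ≠ B) (c : Crossing) :
    c.smoothing A B + c.opp.smoothing A B * mu A B a + loopCoeff A B a = c.opp.curlFactor a := by
  have h : A - B ≠ 0 := sub_ne_zero.mpr hAB
  unfold mu loopCoeff
  cases c <;> simp only [Crossing.smoothing, Crossing.opp, Crossing.curlFactor] <;>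
    generalize a⁻¹ = b <;> field_simp <;> ring

theorem gam_eq_bigonCoeff (hAB : A ≠ B) :
    gam A B a = bigonCoeff A B (mu A B a) (loopCoeff A B a) := by
  have h : A - B ≠ 0 := sub_ne_zero.mpr hAB
  unfold mu loopCoeff gam bigonCoeff
  generalize a⁻¹ = b
  field_simp
  ring

theorem xi_eq_triangleCoeff (hAB : A ≠ B) :
    xi A B a = triangleCoeff A B (mu A B a) (loopCoeff A B a) := by
  have h : A - B ≠ 0 := sub_ne_zero.mpr hAB
  rw [triangleCoeff, ← gam_eq_bigonCoeff a hAB]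
  unfold xi loopCoeff gam
  generalize a⁻¹ = b
  field_simp
  ring

end Coefficients

section GraphicalCalculus

open SkeinAlgebra

variable {K : Type*} [Field K] {A B a : K} {P : Diagram → K}

theorem GraphicalCalculus.twoStrandRelations (hc : GraphicalCalculus A B a P) (hAB : A ≠ B)
    (hP : IsPlanarInvariant P) :
    TwoStrandRelations A B (mu A B a) (loopCoeff A B a)
      (of P horizontal) (of P (single .vertex)) := by
  have circle : value P circleBeside = mu A B a • value P (strands 1) := funext hc.circle
  have loop : value P (curlRight .vertex) = loopCoeff A B a • value P (strands 1) :=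
    funext hc.loop
  constructor <;> apply toValue_injective <;> simp only [← map_mul, toValue_of, map_smul]
  · exact hP.value_horizontal_mul_horizontal.trans
      (value_context_eq_smul circle 1 0 (strands 2) horizontal)
  · exact (hP.value_horizontal_mul_node .vertex).trans
      (value_context_eq_smul loop 1 0 horizontal (strands 2))
  · exact (hP.value_node_mul_horizontal .vertex).trans
      (value_context_eq_smul loop 1 0 (strands 2) horizontal)
  · simp only [map_sub, map_add, map_smul, ← map_one (of P), toValue_of, ← gam_eq_bigonCoeff a hAB]
    exact funext hc.bigon

theorem GraphicalCalculus.threeStrandRelations (hc : GraphicalCalculus A B a P) (hAB : A ≠ B)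
    (hP : IsPlanarInvariant P) :
    ThreeStrandRelations A B (mu A B a) (loopCoeff A B a)
      (of P arcs12) (of P arc34) (of P arcs23) (of P arc61) where
  left := by
    have h := (hc.twoStrandRelations hAB hP).map (pad P 2 0 1)
    simp only [pad_of] at h
    exact h
  right := by
    have h := (hc.twoStrandRelations hAB hP).map (pad P 2 1 0)
    simp only [pad_of] at h
    exact h
  straighten_left := by
    simp only [← map_mul, of_eq_of_iff, hP.value_arcs12_mul_arcs23_mul_arcs12]
  straighten_right := by
    simp only [← map_mul, of_eq_of_iff, hP.value_arcs23_mul_arcs12_mul_arcs23]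
  turn_above := by
    simp only [← map_mul, of_eq_of_iff, hP.value_arcs12_mul_arc61,
      hP.value_arcs12_mul_arcs23_mul_arc34]
  turn_below := by
    simp only [← map_mul, of_eq_of_iff, hP.value_arc61_mul_arcs12,
      hP.value_arc34_mul_arcs23_mul_arcs12]
  triangle := by
    apply toValue_injective
    simp only [← map_mul, map_sub, map_add, map_smul, toValue_of, hP.value_arcs12_mul_arc61,
      hP.value_arc61_mul_arcs12, ← xi_eq_triangleCoeff a hAB]
    exact funext hc.triangle

theorem SkeinRelation.value_crossing (hs : SkeinRelation A B P) (hP : IsPlanarInvariant P)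
    (c : Crossing) :
    value P (single (.crossing c)) = c.smoothing A B • value P (strands 2) +
      c.opp.smoothing A B • value P horizontal + value P (single .vertex) := by
  have backslash : value P (single (.crossing .backslash)) =
      A • value P horizontal + B • value P (strands 2) + value P (single .vertex) := funext hs
  have rotate_vertex : value P (single .vertex).rotate = value P (single .vertex) :=
    hP.value_rotate_node .vertex
  cases c with
  | backslash =>
    rw [backslash, add_comm (A • _)]
    rfl
  | slash =>
    calc value P (single (.crossing .slash))
      _ = rotateMap K (value P (single (.crossing .backslash))) :=
        (hP.value_rotate_node (.crossing .slash)).symm.trans (rotateMap_value P _).symm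
      _ = A • value P (strands 2) + B • value P horizontal + value P (single .vertex) := by
        simp only [backslash, map_add, map_smul, rotateMap_value, hP.value_rotate_horizontal,
          hP.value_rotate_strands, rotate_vertex]

theorem SkeinRelation.of_crossing (hs : SkeinRelation A B P) (hP : IsPlanarInvariant P)
    (c : Crossing) :
    of P (single (.crossing c)) = resolution (c.smoothing A B) (c.opp.smoothing A B)
      (of P horizontal) (of P (single .vertex)) := by
  apply toValue_injective
  simp only [resolution, map_add, map_smul, ← map_one (of P), toValue_of,
    hs.value_crossing hP]
  rfl

/-- A node on the two strands on the left of three. -/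
def nodeLeft (x : Node) : Tangle 3 3 := ⟨[nd x 0], rfl⟩

/-- A node on the two strands on the right of three. -/
def nodeRight (x : Node) : Tangle 3 3 := ⟨[nd x 1], rfl⟩

theorem SkeinRelation.of_crossing_left (hs : SkeinRelation A B P) (hP : IsPlanarInvariant P)
    (c : Crossing) :
    of P (nodeLeft (.crossing c)) =
      resolution (c.smoothing A B) (c.opp.smoothing A B) (of P arcs12) (of P arc34) := by
  have h := congrArg (pad P 2 0 1) (hs.of_crossing hP c)
  simp only [map_resolution, pad_of] at h
  exact h

theorem SkeinRelation.of_crossing_right (hs : SkeinRelation A B P) (hP : IsPlanarInvariant P)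
    (c : Crossing) :
    of P (nodeRight (.crossing c)) =
      resolution (c.smoothing A B) (c.opp.smoothing A B) (of P arcs23) (of P arc61) := by
  have h := congrArg (pad P 2 1 0) (hs.of_crossing hP c)
  simp only [map_resolution, pad_of] at h
  exact h

theorem GraphicalCalculus.value_eq_of_reidemeisterRule (hc : GraphicalCalculus A B a P)
    (hAB : A ≠ B) (hP : IsPlanarInvariant P) (hs : SkeinRelation A B P)
    {S T : Tangle m n} (h : ReidemeisterRule S T) : value P S = value P T := by
  have two := (hc.twoStrandRelations hAB hP).smoothing
  have three := (hc.threeStrandRelations hAB hP).smoothing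
  cases h with
  | move_II c =>
    suffices of P (single (.crossing c) * single (.crossing c.opp)) = of P 1 from
      of_eq_of_iff.mp this
    rw [map_mul, hs.of_crossing hP, hs.of_crossing hP, c.opp_opp, (two c).resolution_mul_swap,
      map_one]
  | move_III c y =>
    suffices of P (nodeLeft (.crossing c) * nodeRight (.crossing c) * nodeLeft (.crossing y)) =
        of P (nodeRight (.crossing y) * (nodeLeft (.crossing c) * nodeRight (.crossing c))) from
      of_eq_of_iff.mp this
    simp only [map_mul, hs.of_crossing_left hP, hs.of_crossing_right hP,
      (three c).slide_resolution]
  | move_IV c =>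
    suffices of P (nodeLeft (.crossing c) * nodeRight (.crossing c) * arc34) =
        of P (arc61 * (nodeLeft (.crossing c) * nodeRight (.crossing c))) from
      of_eq_of_iff.mp this
    simp only [map_mul, hs.of_crossing_left hP, hs.of_crossing_right hP, (three c).slide_vertex]
  | move_V c =>
    suffices of P (single (.crossing c) * single .vertex * single (.crossing c.opp)) =
        of P (single .vertex) from of_eq_of_iff.mp this
    rw [map_mul, map_mul, hs.of_crossing hP, hs.of_crossing hP, c.opp_opp,
      (two c).resolution_mul_vertex_mul_swap]

theorem GraphicalCalculus.eq_of_regularlyIsotopic (hc : GraphicalCalculus A B a P) (hAB : A ≠ B)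
    (hP : IsPlanarInvariant P) (hs : SkeinRelation A B P) {D E : Diagram}
    (h : RegularlyIsotopic D E) : P D = P E := by
  induction h with
  | rel D E step =>
    rcases step with planar | ⟨m, n, F, S, T, rule, rfl, rfl⟩
    · exact hP D E (.rel D E planar)
    · exact congrFun (hc.value_eq_of_reidemeisterRule hAB hP hs rule) F
  | refl D => rfl
  | symm D E _ ih => exact ih.symm
  | trans D E G _ _ ih ih' => exact ih.trans ih'

theorem GraphicalCalculus.value_crossing_mul_horizontal (hc : GraphicalCalculus A B a P)
    (hAB : A ≠ B) (hP : IsPlanarInvariant P) (hs : SkeinRelation A B P) (c : Crossing) :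
    value P (single (.crossing c) * horizontal) = c.opp.curlFactor a • value P horizontal := by
  rw [← toValue_of, map_mul, hs.of_crossing hP,
    ((hc.twoStrandRelations hAB hP).smoothing c).resolution_mul_arcs,
    smoothing_add_mul_mu_add_loopCoeff a hAB, map_smul, toValue_of]

theorem GraphicalCalculus.value_curlRight (hc : GraphicalCalculus A B a P) (hAB : A ≠ B)
    (hP : IsPlanarInvariant P) (hs : SkeinRelation A B P) (c : Crossing) :
    value P (curlRight (.crossing c)) = c.curlFactor a • value P (strands 1) := by
  have h := hc.value_crossing_mul_horizontal hAB hP hs c.opp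
  rw [c.opp_opp] at h
  exact hP.value_curlRight_eq_smul h

theorem GraphicalCalculus.value_curlLeft (hc : GraphicalCalculus A B a P) (hAB : A ≠ B)
    (hP : IsPlanarInvariant P) (hs : SkeinRelation A B P) (c : Crossing) :
    value P (curlLeft (.crossing c)) = c.curlFactor a • value P (strands 1) := by
  have h := hc.value_crossing_mul_horizontal hAB hP hs c.opp
  rw [c.opp_opp] at h
  exact hP.value_curlLeft_eq_smul h

end GraphicalCalculus

end RigidGraph

theorem mainTheorem3 {K : Type*} [Field K] (A B a : K) (hAB : A ≠ B) (ha : a ≠ 0)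
    (P : RigidGraph.Diagram → K)
    (hP : ∀ D E : RigidGraph.Diagram, RigidGraph.PlanarIsotopic D E → P D = P E)
    (hcalc : RigidGraph.GraphicalCalculus A B a P)
    (hskein : RigidGraph.SkeinRelation A B P) :
    (∀ D E : RigidGraph.Diagram, RigidGraph.RegularlyIsotopic D E → P D = P E) ∧
    (∀ F : RigidGraph.Frame 1 1,
      P (F.fill (RigidGraph.curlRight (.crossing .slash))) =
          a * P (F.fill (RigidGraph.strands 1)) ∧
      P (F.fill (RigidGraph.curlLeft (.crossing .slash))) =
          a * P (F.fill (RigidGraph.strands 1)) ∧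
      P (F.fill (RigidGraph.curlRight (.crossing .backslash))) =
          a⁻¹ * P (F.fill (RigidGraph.strands 1)) ∧
      P (F.fill (RigidGraph.curlLeft (.crossing .backslash))) =
          a⁻¹ * P (F.fill (RigidGraph.strands 1))) := by
  refine ⟨fun D E => hcalc.eq_of_regularlyIsotopic hAB hP hskein, fun F => ?_⟩
  have curlRight (c : RigidGraph.Crossing) :=
    congrFun (hcalc.value_curlRight hAB hP hskein c) F
  have curlLeft (c : RigidGraph.Crossing) :=
    congrFun (hcalc.value_curlLeft hAB hP hskein c) F
  exact ⟨curlRight .slash, curlLeft .slash, curlRight .backslash, curlLeft .backslash⟩
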